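/- Let $n\ge 1$ and let $a_1,\dots,a_n\ge 1$, $b_1,\dots,b_n\ge 0$ be integers. Number the coordinates of $\mathbb C^n$ modulo $n$, so that $z_{n+1}=z_1$, and put $$f_{II}(\mathbf z,\bar{\mathbf z})=\sum_{j=1}^{n} z_j^{a_j+b_j}\,\bar z_j^{\,b_j}\,z_{j+1},\qquad g_{II}(\mathbf z)=\sum_{j=1}^{n} z_j^{a_j}z_{j+1},$$ $$f_{II,t}=(1-t)f_{II}+t\,g_{II},\qquad V_t=f_{II,t}^{-1}(0)\subset\mathbb C^n,\qquad 0\le t\le 1 .$$ Assume that $b_j\ge 1$ for some $j$, that $a_k\ge 2$ for some $k$, and that $g_{II}$ is weighted homogeneous with positive weights, i.e. there are positive integers $p_1,\dots,p_n,d$ with $a_jp_j+p_{j+1}=d$ for all $j$ (where $p_{n+1}=p_1$). (Given the other assumptions, the last one fails only if $n$ is even and $a_j=1$ for all even $j$, or $a_j=1$ for all odd $j$.) Then for every $r>0$ and every $t\in[0,1]$ the sphere $S^{2n-1}_r=\{\|\mathbf z\|=r\}$ and $V_t$ are transversal. That is, at every $\mathbf w\in S^{2n-1}_r\cap V_t$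 the real differential of $f_{II,t}:\mathbb C^n\to\mathbb C$ is surjective (so $V_t$ is a smooth real submanifold of codimension $2$ near $\mathbf w$, with tangent space $T_{\mathbf w}V_t=\ker d(f_{II,t})_{\mathbf w}$), and $T_{\mathbf w}V_t+T_{\mathbf w}S^{2n-1}_r=\mathbb C^n$. -/

import Mathlib

open scoped ComplexConjugate

noncomputable section

/-- The mixed polynomial of cyclic type
`f_II(z, z̄) = ∑ j, z_j ^ (a_j + b_j) * z̄_j ^ b_j * z_{j+1}` on `ℂⁿ` with its Euclidean norm.
Addition in `Fin n` is modulo `n`, so the successor of the last index is the first one. -/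
def fII {n : ℕ} [NeZero n] (a b : Fin n → ℕ) (z : EuclideanSpace ℂ (Fin n)) : ℂ :=
  ∑ j : Fin n, z j ^ (a j + b j) * conj (z j) ^ b j * z (j + 1)

/-- The associated polynomial `g_II(z) = ∑ j, z_j ^ a_j * z_{j+1}`. -/
def gII {n : ℕ} [NeZero n] (a : Fin n → ℕ) (z : EuclideanSpace ℂ (Fin n)) : ℂ :=
  ∑ j : Fin n, z j ^ a j * z (j + 1)

/-- The family `f_{II,t} = (1 - t) f_II + t g_II`. -/
def fIIt {n : ℕ} [NeZero n] (a b : Fin n → ℕ) (t : ℝ) (z : EuclideanSpace ℂ (Fin n)) : ℂ :=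
  (1 - (t : ℂ)) * fII a b z + (t : ℂ) * gII a z

/-- The hypersurface `V_t = f_{II,t}⁻¹(0)`. -/
def Vt {n : ℕ} [NeZero n] (a b : Fin n → ℕ) (t : ℝ) : Set (EuclideanSpace ℂ (Fin n)) :=
  {z | fIIt a b t z = 0}

/-- `g_II` is weighted homogeneous in the usual sense, with positive integer weights `p_j`:
every monomial `z_j ^ a_j * z_{j+1}` has the same weighted degree `d`. -/
def HasPositiveWeights {n : ℕ} [NeZero n] (a : Fin n → ℕ) : Prop :=
  ∃ (p : Fin n → ℕ) (d : ℕ), (∀ j, 0 < p j) ∧ ∀ j, a j * p j + p (j + 1) = d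

/-- The level sets of `F` and `H` through `w` are transversal at `w`: both maps are submersive
at `w`, so that their level sets through `w` are submanifolds near `w` with tangent spaces
`ker dF_w` and `ker dH_w`, and these tangent spaces together span the ambient space. -/
structure LevelSetsTransversalAt {E G K : Type*} [NormedAddCommGroup E] [NormedSpace ℝ E]
    [NormedAddCommGroup G] [NormedSpace ℝ G] [NormedAddCommGroup K] [NormedSpace ℝ K]
    (F : E → G) (H : E → K) (w : E) : Prop where
  differentiableAt_left : DifferentiableAt ℝ F w
  differentiableAt_right : DifferentiableAt ℝ H w
  regular_left : Function.Surjective (fderiv ℝ F w)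
  regular_right : Function.Surjective (fderiv ℝ H w)
  tangent_sup : LinearMap.ker (fderiv ℝ F w).toLinearMap ⊔
    LinearMap.ker (fderiv ℝ H w).toLinearMap = ⊤

/-- The sphere of radius `r` about the origin, a level set of `z ↦ ‖z‖ ^ 2`, and `V_t` are
transversal, i.e. transversal at each of their common points. -/
def SphereTransversal {n : ℕ} [NeZero n] (a b : Fin n → ℕ) (t r : ℝ) : Prop :=
  ∀ w ∈ Metric.sphere (0 : EuclideanSpace ℂ (Fin n)) r ∩ Vt a b t,
    LevelSetsTransversalAt (fIIt a b t)
      (fun z : EuclideanSpace ℂ (Fin n) => ‖z‖ ^ 2) w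

end

/-! ### Cyclic linear systems and positivity of weights. -/

section Cyclic

variable {n : ℕ} [NeZero n]

/-! Transversality fails at `w` only if some nonzero covector `(lam, μ)` kills the differentials of
`f_{II,t}` and `‖z‖²` jointly. Let `N j` be `lam` times the `j`-th term of `f_{II,t}(w)`. Rotating
one coordinate gives a homogeneous cyclic system for `Im N` with coefficients `a j`, so `Im N = 0`.
Scaling one coordinate gives a system for `Re N` with real exponents `c j ≥ a j` depending on `w`,
and right-hand side `-2μ|w_j|²`. Positive weights for `c` (`exists_real_weights`) combine these
equations into `∑ Re N j = -2μ ∑ q j |w_j|²`; the left side vanishes on `V_t`, so `μ = 0`, and then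
`N = 0`. If `lam ≠ 0`, adjacent coordinates of `w` have product zero, and the equations at the
vanishing coordinates force every second `a j` to be `1`, which `HasPositiveWeights.eq_one`
excludes. -/

theorem Fin.cyclic_induction {Q : Fin n → Prop} {k : Fin n} (h0 : Q k)
    (hs : ∀ j, Q j → Q (j + 1)) (j : Fin n) : Q j := by
  have key : ∀ m : ℕ, Q (k + m • (1 : Fin n)) := by
    intro m
    induction m with
    | zero => simpa using h0
    | succ m ih =>
      rw [succ_nsmul, ← add_assoc]
      exact hs _ ih
  have h := key (j - k).val
  have e : ((j - k).val • (1 : Fin n)) = j - k := by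
    have hcast : ∀ m : ℕ, m • (1 : Fin n) = Fin.ofNat n m := by
      intro m
      induction m with
      | zero => simp
      | succ m ih =>
        rw [succ_nsmul, ih, Fin.ext_iff]
        simp [Fin.val_add, Nat.add_mod]
    rw [hcast, Fin.ofNat_val_eq_self]
  rwa [e, add_sub_cancel] at h

theorem Fin.sum_add_one {M : Type*} [AddCommMonoid M] (y : Fin n → M) :
    ∑ j, y (j + 1) = ∑ j, y j :=
  Equiv.sum_comp (Equiv.addRight (1 : Fin n)) y

/-- Both sides of the inequality have the same sum over the cycle, so every inequality is an
equality. -/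
theorem Fin.eq_of_forall_le_add_one {y : Fin n → ℝ} (h : ∀ j, y j ≤ y (j + 1)) (i j : Fin n) :
    y i = y j := by
  have e := (Finset.sum_eq_sum_iff_of_le (s := Finset.univ) (fun i _ => h i)).1
    (Fin.sum_add_one y).symm
  have hc : ∀ k, y k = y i :=
    Fin.cyclic_induction rfl fun j hj => by rw [← e j (Finset.mem_univ j), hj]
  exact (hc j).symm

/-- A cyclic system `c_{j+1} u_{j+1} + u_j = 0` has only the trivial solution when all
`c_j ≥ 1` and one of them is larger. -/
theorem eq_zero_of_cyclic_system {c u : Fin n → ℝ} (hc : ∀ j, 1 ≤ c j) (hk : ∃ k, 1 < c k)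
    (h : ∀ j, c (j + 1) * u (j + 1) + u j = 0) (j : Fin n) : u j = 0 := by
  have habs : ∀ j, |u j| = c (j + 1) * |u (j + 1)| := fun j => by
    rw [eq_neg_of_add_eq_zero_right (h j), abs_neg, abs_mul,
      abs_of_nonneg (zero_le_one.trans (hc (j + 1)))]
  -- `|u|` cannot increase along the cycle, so it is constant; an index with `c k > 1` then makes it
  -- zero.
  have hconst := Fin.eq_of_forall_le_add_one (y := fun j => -|u j|) fun j => by
    have := habs j
    nlinarith [hc (j + 1), abs_nonneg (u (j + 1))]
  obtain ⟨k, hk⟩ := hk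
  have h1 := habs (k - 1)
  rw [sub_add_cancel] at h1
  have h2 := hconst (k - 1) k
  have h3 := hconst j k
  simp only [neg_inj] at h2 h3
  have : |u k| = 0 := by nlinarith [abs_nonneg (u k)]
  exact abs_eq_zero.1 (h3.trans this)

/-- If `a_{k+1}, a_{k+3}, …` are all `1`, then a weighted homogeneous cyclic polynomial has all
its exponents equal to `1`. -/
theorem HasPositiveWeights.eq_one {a : Fin n → ℕ} (hw : HasPositiveWeights a)
    (ha : ∀ j, 1 ≤ a j) {k : Fin n} (hk : ∀ i, a (k + i + i + 1) = 1) (j : Fin n) : a j = 1 := by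
  obtain ⟨p, d, hp, hd⟩ := hw
  have hstep : ∀ i, p (k + i + i + 1) + p (k + i + i + 1 + 1) = d := fun i => by
    simpa [hk i] using hd (k + i + i + 1)
  have hidx : ∀ i : Fin n, k + (i + 1) + (i + 1) = k + i + i + 1 + 1 := fun i => by abel
  -- Comparing two consecutive weight equations shows that `p` does not increase under a shift by
  -- two, hence is constant along such shifts; equality forces the exponent in between to be `1`.
  have hconst := Fin.eq_of_forall_le_add_one (y := fun i => -(p (k + i + i + 1) : ℝ)) fun i => by
    have h1 := hstep i
    have h2 := hd (k + i + i + 1 + 1)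
    have h3 := Nat.mul_le_mul_right (p (k + i + i + 1 + 1)) (ha (k + i + i + 1 + 1))
    simp only [hidx, neg_le_neg_iff, Nat.cast_le]
    omega
  have hall : ∀ i, a (k + i + i + 1 + 1) = 1 := fun i => by
    have h1 := hstep i
    have h2 := hd (k + i + i + 1 + 1)
    have h3 := hconst (i + 1) i
    simp only [hidx, neg_inj, Nat.cast_inj] at h3
    have h4 := hp (k + i + i + 1 + 1)
    have h5 : a (k + i + i + 1 + 1) * p (k + i + i + 1 + 1) = 1 * p (k + i + i + 1 + 1) := by omega
    exact Nat.eq_of_mul_eq_mul_right h4 h5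
  -- For odd `n` the two classes coincide, which does no harm.
  have hpar : ∀ j : Fin n, (∃ i, j = k + i + i + 1) ∨ ∃ i, j = k + i + i + 1 + 1 := by
    refine Fin.cyclic_induction (k := k + 1) (.inl ⟨0, by simp⟩) fun j hj => ?_
    rcases hj with ⟨i, rfl⟩ | ⟨i, rfl⟩
    · exact .inr ⟨i, rfl⟩
    · exact .inl ⟨i + 1, by rw [hidx]⟩
  rcases hpar j with ⟨i, rfl⟩ | ⟨i, rfl⟩
  · exact hk i
  · exact hall i

/-- Raising the exponents of a weighted homogeneous cyclic polynomial to real numbers `c_j ≥ a_j`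
keeps the normalized weights positive. -/
theorem HasPositiveWeights.exists_real_weights {a : Fin n → ℕ} (hw : HasPositiveWeights a)
    (ha : ∀ j, 1 ≤ a j) (ha2 : ∃ k, 2 ≤ a k) {c : Fin n → ℝ} (hc : ∀ j, (a j : ℝ) ≤ c j) :
    ∃ q : Fin n → ℝ, (∀ j, 0 < q j) ∧ ∀ j, c j * q j + q (j + 1) = 1 := by
  have ha' : ∀ j, (1 : ℝ) ≤ a j := fun j => by exact_mod_cast ha j
  have hc1 : ∀ j, 1 ≤ c j := fun j => (ha' j).trans (hc j)
  obtain ⟨k, hk⟩ := ha2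
  have hk' : (2 : ℝ) ≤ a k := by exact_mod_cast hk
  have hck : 1 < c k := by linarith [hc k]
  let T : (Fin n → ℝ) →ₗ[ℝ] (Fin n → ℝ) :=
    { toFun := fun q j => c j * q j + q (j + 1)
      map_add' := fun x y => by ext j; simp only [Pi.add_apply]; ring
      map_smul' := fun r x => by
        ext j; simp only [Pi.smul_apply, smul_eq_mul, RingHom.id_apply]; ring }
  have hinj : Function.Injective T := by
    rw [← LinearMap.ker_eq_bot, LinearMap.ker_eq_bot']
    intro q hq
    have hq' : ∀ j, c j * q j + q (j + 1) = 0 := fun j => congrFun hq j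
    -- Here the coefficient sits on the earlier index, so the cycle is reversed.
    have key := eq_zero_of_cyclic_system (c := fun j => c (-j)) (u := fun j => q (-j))
      (fun j => hc1 _) ⟨-k, by simpa using hck⟩ fun j => by
        have := hq' (-(j + 1))
        rwa [show -(j + 1) + 1 = -j by abel] at this
    ext j
    simpa using key (-j)
  obtain ⟨q, hq⟩ := LinearMap.injective_iff_surjective.1 hinj (fun _ => 1)
  have hq' : ∀ j, c j * q j + q (j + 1) = 1 := fun j => congrFun hq j
  refine ⟨q, ?_, hq'⟩
  obtain ⟨l, hl⟩ := Finite.exists_min q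
  suffices 0 < q l from fun j => this.trans_le (hl j)
  -- A minimum `q l ≤ 0` forces the maximum `1 - q l` at the next index, then `c = 1` there and the
  -- minimum again two steps on. So every second `a` is `1`.
  by_contra! hneg
  have hmax : ∀ j, q j ≤ 1 - q l := fun j => by
    have h1 := hq' j
    have h2 := hl (j + 1)
    rcases le_or_gt (q j) 0 with h | h <;> nlinarith [hc1 j]
  have hnext : ∀ j, q j = q l → q (j + 1) = 1 - q l := fun j hj => by
    have h1 := hq' j
    have h2 := hmax (j + 1)
    rw [hj] at h1
    nlinarith [hc1 j]
  have hone : ∀ j, q j = q l → c (j + 1) = 1 ∧ q (j + 1 + 1) = q l := fun j hj => by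
    have h1 := hq' (j + 1)
    rw [hnext j hj] at h1
    have h2 := hl (j + 1 + 1)
    have h3 : c (j + 1) = 1 := le_antisymm (by nlinarith) (hc1 _)
    rw [h3] at h1
    exact ⟨h3, by linarith⟩
  have hall : ∀ i, q (l + i + i) = q l :=
    Fin.cyclic_induction (k := 0) (by simp) fun i hi => by
      rw [show l + (i + 1) + (i + 1) = l + i + i + 1 + 1 by abel]
      exact (hone _ hi).2
  have := hw.eq_one ha (k := l) (fun i => by
    have h1 := (hone _ (hall i)).1
    have h2 := hc (l + i + i + 1)
    rw [h1] at h2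
    exact le_antisymm (by exact_mod_cast h2) (ha _)) k
  omega

end Cyclic

/-! ### Wirtinger calculus for the terms of `f_{II,t}`. -/

section Derivative

/-- The one-variable factor `(1 - t) ζ^{m+l} ζ̄^l + t ζ^m` of the summands of `f_{II,t}`. -/
noncomputable def mixedMonomial (m l : ℕ) (t : ℝ) (ζ : ℂ) : ℂ :=
  (1 - (t : ℂ)) * (ζ ^ (m + l) * conj ζ ^ l) + t * ζ ^ m

/-- The Wirtinger derivative of `mixedMonomial` in `ζ`. -/
noncomputable def mixedMonomialDeriv (m l : ℕ) (t : ℝ) (ζ : ℂ) : ℂ :=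
  (1 - (t : ℂ)) * (((m + l : ℕ) : ℂ) * ζ ^ (m + l - 1) * conj ζ ^ l) + t * (m * ζ ^ (m - 1))

/-- The Wirtinger derivative of `mixedMonomial` in `ζ̄`. -/
noncomputable def mixedMonomialDerivConj (m l : ℕ) (t : ℝ) (ζ : ℂ) : ℂ :=
  (1 - (t : ℂ)) * (ζ ^ (m + l) * (l * conj ζ ^ (l - 1)))

theorem hasFDerivAt_mixedMonomial (m l : ℕ) (t : ℝ) (ζ : ℂ) :
    HasFDerivAt (𝕜 := ℝ) (mixedMonomial m l t)
      (mixedMonomialDeriv m l t ζ • ContinuousLinearMap.id ℝ ℂ +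
        mixedMonomialDerivConj m l t ζ • Complex.conjCLE.toContinuousLinearMap) ζ := by
  have hid : HasFDerivAt (𝕜 := ℝ) (fun ζ : ℂ => ζ) (ContinuousLinearMap.id ℝ ℂ) ζ :=
    hasFDerivAt_id ζ
  have hconj : HasFDerivAt (𝕜 := ℝ) (fun ζ : ℂ => conj ζ) Complex.conjCLE.toContinuousLinearMap ζ :=
    Complex.conjCLE.toContinuousLinearMap.hasFDerivAt
  have h := (((hid.pow (m + l)).mul (hconj.pow l)).const_mul (1 - (t : ℂ))).add
    ((hid.pow m).const_mul (t : ℂ))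
  refine h.congr_fderiv ?_
  ext v
  simp [mixedMonomialDeriv, mixedMonomialDerivConj]
  ring

theorem mixedMonomial_ne_zero {m l : ℕ} {t : ℝ} (ht : t ∈ Set.Icc (0 : ℝ) 1) {ζ : ℂ}
    (hζ : ζ ≠ 0) : mixedMonomial m l t ζ ≠ 0 := by
  have hfac : mixedMonomial m l t ζ =
      ζ ^ m * (((1 - t) * Complex.normSq ζ ^ l + t : ℝ) : ℂ) := by
    push_cast
    rw [← Complex.mul_conj, mixedMonomial]
    ring
  have hs : 0 < Complex.normSq ζ ^ l := pow_pos (Complex.normSq_pos.2 hζ) l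
  have hpos : 0 < (1 - t) * Complex.normSq ζ ^ l + t := by
    rcases ht.1.eq_or_lt with h | h
    · simpa [← h] using hs
    · have := mul_nonneg (sub_nonneg.2 ht.2) hs.le
      linarith
  rw [hfac]
  exact mul_ne_zero (pow_ne_zero _ hζ) (Complex.ofReal_ne_zero.2 hpos.ne')

theorem mixedMonomialDeriv_mul_self {m l : ℕ} (hm : 1 ≤ m) (t : ℝ) (ζ : ℂ) :
    mixedMonomialDeriv m l t ζ * ζ =
      (1 - (t : ℂ)) * ((m + l) * (ζ ^ (m + l) * conj ζ ^ l)) + t * (m * ζ ^ m) := by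
  obtain ⟨m, rfl⟩ := Nat.exists_eq_add_of_le' hm
  rw [mixedMonomialDeriv, show m + 1 + l - 1 = m + l by omega, show m + 1 - 1 = m by omega]
  push_cast
  ring

theorem mixedMonomialDerivConj_mul_conj (m l : ℕ) (t : ℝ) (ζ : ℂ) :
    mixedMonomialDerivConj m l t ζ * conj ζ =
      (1 - (t : ℂ)) * (l * (ζ ^ (m + l) * conj ζ ^ l)) := by
  rw [mixedMonomialDerivConj]
  rcases l with _ | l
  · simp
  · rw [show l + 1 - 1 = l by omega]
    ring

/-- Euler's identity for rotations: the monomial is `ζ ^ m` times a function of `|ζ|`, so the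
derivative along `iζ` sees only `m`. -/
theorem mixedMonomial_angular {m l : ℕ} (hm : 1 ≤ m) (t : ℝ) (ζ : ℂ) :
    mixedMonomialDeriv m l t ζ * ζ - mixedMonomialDerivConj m l t ζ * conj ζ =
      m * mixedMonomial m l t ζ := by
  rw [mixedMonomialDeriv_mul_self hm, mixedMonomialDerivConj_mul_conj, mixedMonomial]
  ring

theorem exists_mixedMonomial_radial {m l : ℕ} (hm : 1 ≤ m) {t : ℝ}
    (ht : t ∈ Set.Icc (0 : ℝ) 1) (ζ : ℂ) :
    ∃ c : ℝ, (m : ℝ) ≤ c ∧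
      mixedMonomialDeriv m l t ζ * ζ + mixedMonomialDerivConj m l t ζ * conj ζ =
        c * mixedMonomial m l t ζ := by
  rw [mixedMonomialDeriv_mul_self hm, mixedMonomialDerivConj_mul_conj]
  rcases eq_or_ne ζ 0 with rfl | hζ
  · refine ⟨m, le_rfl, ?_⟩
    simp [mixedMonomial, show m ≠ 0 by omega]
  have hs : 0 < Complex.normSq ζ ^ l := pow_pos (Complex.normSq_pos.2 hζ) l
  set s := Complex.normSq ζ ^ l with hsdef
  have h0 : 0 ≤ (1 - t) * s := mul_nonneg (sub_nonneg.2 ht.2) hs.le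
  have hpos : 0 < (1 - t) * s + t := by
    rcases ht.1.eq_or_lt with h | h
    · simpa [← h] using hs
    · linarith
  -- The logarithmic radial derivative of `|ζ| ^ m * ((1 - t) * |ζ| ^ (2 * l) + t)`.
  refine ⟨m + 2 * l * ((1 - t) * s) / ((1 - t) * s + t), le_add_of_nonneg_right (by positivity), ?_⟩
  have hsc : ζ ^ (m + l) * conj ζ ^ l = ζ ^ m * (s : ℂ) := by
    rw [hsdef]
    push_cast
    rw [← Complex.mul_conj]
    ring
  have hne : (1 - (t : ℂ)) * s + t ≠ 0 := by exact_mod_cast hpos.ne'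
  rw [mixedMonomial, hsc]
  push_cast
  field_simp
  ring

theorem mixedMonomialDerivConj_zero {m l : ℕ} (hm : 1 ≤ m) (t : ℝ) :
    mixedMonomialDerivConj m l t 0 = 0 := by
  simp [mixedMonomialDerivConj, show m ≠ 0 by omega]

theorem mixedMonomialDeriv_zero {m l : ℕ} (hm : 2 ≤ m) (t : ℝ) :
    mixedMonomialDeriv m l t 0 = 0 := by
  simp [mixedMonomialDeriv, show m + l - 1 ≠ 0 by omega, show m - 1 ≠ 0 by omega]

variable {n : ℕ} [NeZero n]

theorem fIIt_eq_sum (a b : Fin n → ℕ) (t : ℝ) (z : EuclideanSpace ℂ (Fin n)) :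
    fIIt a b t z = ∑ j, mixedMonomial (a j) (b j) t (z j) * z (j + 1) := by
  simp only [fIIt, fII, gII, Finset.mul_sum, ← Finset.sum_add_distrib, mixedMonomial]
  exact Finset.sum_congr rfl fun j _ => by ring

theorem exists_hasFDerivAt_fIIt (a b : Fin n → ℕ) (t : ℝ) (w : EuclideanSpace ℂ (Fin n)) :
    ∃ D : EuclideanSpace ℂ (Fin n) →L[ℝ] ℂ, HasFDerivAt (fIIt a b t) D w ∧
      ∀ v, D v = ∑ j, ((mixedMonomialDeriv (a j) (b j) t (w j) * v j +
        mixedMonomialDerivConj (a j) (b j) t (w j) * conj (v j)) * w (j + 1) +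
        mixedMonomial (a j) (b j) t (w j) * v (j + 1)) := by
  have hproj : ∀ j : Fin n, HasFDerivAt (𝕜 := ℝ) (fun z : EuclideanSpace ℂ (Fin n) => z j)
      ((EuclideanSpace.proj j : EuclideanSpace ℂ (Fin n) →L[ℂ] ℂ).restrictScalars ℝ) w := fun j =>
    ((EuclideanSpace.proj j : EuclideanSpace ℂ (Fin n) →L[ℂ] ℂ).restrictScalars ℝ).hasFDerivAt
  have h := HasFDerivAt.fun_sum (u := Finset.univ) fun j _ =>
    (((hasFDerivAt_mixedMonomial (a j) (b j) t (w j)).comp w (hproj j)).mul (hproj (j + 1)))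
  refine ⟨_, h.congr_of_eventuallyEq (.of_forall fun z => fIIt_eq_sum a b t z), fun v => ?_⟩
  simp only [sum_apply]
  refine Finset.sum_congr rfl fun j _ => ?_
  simp
  ring

/-- The variable `z (j + 1)` enters as the base of term `j + 1` and as the linear factor of term
`j`. The formula also covers `n = 1`, where these are the same term. -/
theorem fderiv_fIIt_single (a b : Fin n → ℕ) (t : ℝ) (w : EuclideanSpace ℂ (Fin n))
    (j : Fin n) (ξ : ℂ) :
    fderiv ℝ (fIIt a b t) w (EuclideanSpace.single (j + 1) ξ) =
      (mixedMonomialDeriv (a (j + 1)) (b (j + 1)) t (w (j + 1)) * ξ +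
        mixedMonomialDerivConj (a (j + 1)) (b (j + 1)) t (w (j + 1)) * conj ξ) * w (j + 1 + 1) +
        mixedMonomial (a j) (b j) t (w j) * ξ := by
  obtain ⟨D, hD, hv⟩ := exists_hasFDerivAt_fIIt a b t w
  rw [hD.fderiv, hv, Finset.sum_add_distrib]
  congr 1
  · rw [Finset.sum_eq_single (j + 1)]
    · simp
    · intro i _ hi
      simp [hi]
    · simp
  · rw [Finset.sum_eq_single j]
    · simp
    · intro i _ hi
      simp [hi]
    · simp

end Derivative

/-! ### Annihilating covectors and transversality. -/

section Transversality

/-- Two maps have transversal level sets where the differential of the pair is surjective. -/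
theorem LevelSetsTransversalAt.of_surjective {E G K : Type*} [NormedAddCommGroup E]
    [NormedSpace ℝ E] [NormedAddCommGroup G] [NormedSpace ℝ G] [NormedAddCommGroup K]
    [NormedSpace ℝ K] {F : E → G} {H : E → K} {w : E} (hF : DifferentiableAt ℝ F w)
    (hH : DifferentiableAt ℝ H w)
    (h : Function.Surjective ((fderiv ℝ F w).prod (fderiv ℝ H w))) :
    LevelSetsTransversalAt F H w where
  differentiableAt_left := hF
  differentiableAt_right := hH
  regular_left := fun x => by
    obtain ⟨v, hv⟩ := h (x, 0)
    exact ⟨v, congrArg Prod.fst hv⟩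
  regular_right := fun x => by
    obtain ⟨v, hv⟩ := h (0, x)
    exact ⟨v, congrArg Prod.snd hv⟩
  tangent_sup := by
    refine eq_top_iff.2 fun v _ => ?_
    obtain ⟨x, hx⟩ := h (0, fderiv ℝ H w v)
    have h1 : fderiv ℝ F w x = 0 := congrArg Prod.fst hx
    have h2 : fderiv ℝ H w x = fderiv ℝ H w v := congrArg Prod.snd hx
    exact Submodule.mem_sup.2 ⟨x, h1, v - x, by simp [h2], by abel⟩

theorem LinearMap.exists_re_mul_add_mul (φ : ℂ × ℝ →ₗ[ℝ] ℝ) :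
    ∃ (lam : ℂ) (μ : ℝ), ∀ z s, φ (z, s) = (lam * z).re + μ * s := by
  refine ⟨⟨φ (1, 0), -φ (Complex.I, 0)⟩, φ (0, 1), fun z s => ?_⟩
  have e : ((z, s) : ℂ × ℝ) = z.re • ((1 : ℂ), (0 : ℝ)) + z.im • (Complex.I, (0 : ℝ)) +
      s • ((0 : ℂ), (1 : ℝ)) := by
    ext <;> simp
  rw [e, map_add, map_add, map_smul, map_smul, map_smul]
  simp
  ring

theorem fderiv_norm_sq_single {n : ℕ} (w : EuclideanSpace ℂ (Fin n)) (j : Fin n) (ξ : ℂ) :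
    fderiv ℝ (fun z : EuclideanSpace ℂ (Fin n) => ‖z‖ ^ 2) w (EuclideanSpace.single j ξ) =
      2 * (conj (w j) * ξ).re := by
  have hD : HasFDerivAt (𝕜 := ℝ) (fun z : EuclideanSpace ℂ (Fin n) => ‖z‖ ^ 2) _ w :=
    (hasStrictFDerivAt_norm_sq w).hasFDerivAt
  rw [hD.fderiv]
  have hin : inner ℝ w (EuclideanSpace.single j ξ) = (conj (w j) * ξ).re := by
    rw [PiLp.inner_apply, Finset.sum_eq_single j]
    · simp [Complex.inner]
      ring
    · intro i _ hi
      simp [hi]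
    · simp
  simp only [smul_apply, innerSL_apply_apply, hin, nsmul_eq_mul, Nat.cast_ofNat]

variable {n : ℕ} [NeZero n]

/-- A covector that annihilates the differentials of `f_{II,t}` and of `‖z‖²` jointly at a nonzero
point of `V_t` is trivial. -/
theorem covector_eq_zero {a b : Fin n → ℕ} (ha : ∀ j, 1 ≤ a j) (ha2 : ∃ k, 2 ≤ a k)
    (hw : HasPositiveWeights a) {t : ℝ} (ht : t ∈ Set.Icc (0 : ℝ) 1)
    {w : EuclideanSpace ℂ (Fin n)} (hw0 : w ≠ 0) (hV : fIIt a b t w = 0) {lam : ℂ} {μ : ℝ}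
    (h : ∀ v, (lam * fderiv ℝ (fIIt a b t) w v).re +
      μ * fderiv ℝ (fun z : EuclideanSpace ℂ (Fin n) => ‖z‖ ^ 2) w v = 0) :
    lam = 0 ∧ μ = 0 := by
  obtain ⟨k₂, hk₂⟩ := id ha2
  have ha' : ∀ j, (1 : ℝ) ≤ a j := fun j => by exact_mod_cast ha j
  have hk₂' : (2 : ℝ) ≤ a k₂ := by exact_mod_cast hk₂
  choose c hc hcr using fun j => exists_mixedMonomial_radial (l := b j) (ha j) ht (w j)
  set N : Fin n → ℂ := fun j => lam * (mixedMonomial (a j) (b j) t (w j) * w (j + 1)) with hN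
  have hsingle : ∀ j ξ, (lam * ((mixedMonomialDeriv (a (j + 1)) (b (j + 1)) t (w (j + 1)) * ξ +
      mixedMonomialDerivConj (a (j + 1)) (b (j + 1)) t (w (j + 1)) * conj ξ) * w (j + 1 + 1) +
      mixedMonomial (a j) (b j) t (w j) * ξ)).re + μ * (2 * (conj (w (j + 1)) * ξ).re) = 0 :=
    fun j ξ => by
      rw [← fderiv_fIIt_single, ← fderiv_norm_sq_single]
      exact h _
  have hRe : ∀ j, c (j + 1) * (N (j + 1)).re + (N j).re =
      -2 * μ * Complex.normSq (w (j + 1)) := fun j => by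
    have h1 := hsingle j (w (j + 1))
    rw [hcr, mul_comm (conj _), Complex.mul_conj, Complex.ofReal_re] at h1
    have e : lam * (↑(c (j + 1)) * mixedMonomial (a (j + 1)) (b (j + 1)) t (w (j + 1)) *
        w (j + 1 + 1) + mixedMonomial (a j) (b j) t (w j) * w (j + 1)) =
        c (j + 1) * N (j + 1) + N j := by
      simp only [hN]
      ring
    rw [e, Complex.add_re, Complex.re_ofReal_mul] at h1
    linarith
  have hIm : ∀ j, (N j).im = 0 := by
    refine eq_zero_of_cyclic_system ha' ⟨k₂, by linarith⟩ fun j => ?_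
    have h1 := hsingle j (Complex.I * w (j + 1))
    have e : lam * ((mixedMonomialDeriv (a (j + 1)) (b (j + 1)) t (w (j + 1)) *
        (Complex.I * w (j + 1)) + mixedMonomialDerivConj (a (j + 1)) (b (j + 1)) t (w (j + 1)) *
        conj (Complex.I * w (j + 1))) * w (j + 1 + 1) +
        mixedMonomial (a j) (b j) t (w j) * (Complex.I * w (j + 1))) =
        Complex.I * (((a (j + 1) : ℝ) : ℂ) * N (j + 1) + N j) := by
      have h2 := mixedMonomial_angular (l := b (j + 1)) (ha (j + 1)) t (w (j + 1))
      simp only [hN, map_mul, Complex.conj_I, Complex.ofReal_natCast]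
      linear_combination lam * Complex.I * w (j + 1 + 1) * h2
    -- Rotation is tangent to the sphere: this product is purely imaginary, so `μ` drops out.
    have e2 : conj (w (j + 1)) * (Complex.I * w (j + 1)) =
        Complex.I * (Complex.normSq (w (j + 1)) : ℂ) := by
      rw [← Complex.mul_conj]
      ring
    rw [e, e2, Complex.I_mul_re, Complex.I_mul_re, Complex.add_im, Complex.im_ofReal_mul,
      Complex.ofReal_im] at h1
    linarith
  have hsum : ∑ j, (N j).re = 0 := by
    rw [← Complex.re_sum]
    simp only [hN]
    rw [← Finset.mul_sum, ← fIIt_eq_sum, hV, mul_zero, Complex.zero_re]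
  obtain ⟨k, hk⟩ : ∃ k, w k ≠ 0 := by
    by_contra! hall
    exact hw0 (by ext j; simpa using hall j)
  have hμ : μ = 0 := by
    obtain ⟨q, hq, hqc⟩ := hw.exists_real_weights ha ha2 hc
    have h1 : ∑ j, q (j + 1) * (c (j + 1) * (N (j + 1)).re + (N j).re) = ∑ j, (N j).re := by
      simp only [mul_add, Finset.sum_add_distrib]
      rw [Fin.sum_add_one fun j => q j * (c j * (N j).re), ← Finset.sum_add_distrib]
      refine Finset.sum_congr rfl fun j _ => ?_
      linear_combination (N j).re * hqc j
    have h2 : ∑ j, q (j + 1) * (c (j + 1) * (N (j + 1)).re + (N j).re) =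
        -2 * μ * ∑ j, q j * Complex.normSq (w j) := by
      rw [← Fin.sum_add_one fun j => q j * Complex.normSq (w j), Finset.mul_sum]
      refine Finset.sum_congr rfl fun j _ => ?_
      rw [hRe]
      ring
    have hpos : 0 < ∑ j, q j * Complex.normSq (w j) :=
      Finset.sum_pos' (fun j _ => mul_nonneg (hq j).le (Complex.normSq_nonneg _))
        ⟨k, Finset.mem_univ k, mul_pos (hq k) (Complex.normSq_pos.2 hk)⟩
    rw [h1, hsum] at h2
    rcases mul_eq_zero.1 h2.symm with h3 | h3
    · linarith
    · exact absurd h3 hpos.ne'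
  refine ⟨?_, hμ⟩
  by_contra hlam
  have hN0 : ∀ j, (N j).re = 0 :=
    eq_zero_of_cyclic_system (fun j => (ha' j).trans (hc j))
      ⟨k₂, by linarith [hc k₂]⟩ fun j => by rw [hRe, hμ]; ring
  have hadj : ∀ j, w j ≠ 0 → w (j + 1) = 0 := fun j hj => by
    have h1 : N j = 0 := Complex.ext (hN0 j) (hIm j)
    simpa [hN, hlam, mixedMonomial_ne_zero ht hj] using h1
  have hstep : ∀ j, w j ≠ 0 → a (j + 1) = 1 ∧ w (j + 1 + 1) ≠ 0 := fun j hj => by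
    have h0 := hadj j hj
    set x := lam * (mixedMonomialDeriv (a (j + 1)) (b (j + 1)) t 0 * w (j + 1 + 1) +
      mixedMonomial (a j) (b j) t (w j)) with hx
    -- With this test vector the holomorphic part becomes `|x|²`, so its vanishing real part gives
    -- `x = 0`; the antiholomorphic part is zero at `w (j + 1) = 0`.
    have h1 := hsingle j (conj x)
    rw [h0, hμ, zero_mul, add_zero, mixedMonomialDerivConj_zero (ha _), zero_mul, add_zero,
      show lam * (mixedMonomialDeriv (a (j + 1)) (b (j + 1)) t 0 * conj x * w (j + 1 + 1) +
        mixedMonomial (a j) (b j) t (w j) * conj x) = x * conj x by rw [hx]; ring,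
      Complex.mul_conj, Complex.ofReal_re, Complex.normSq_eq_zero, hx] at h1
    have h2 := (mul_eq_zero.1 h1).resolve_left hlam
    have hH := mixedMonomial_ne_zero (m := a j) (l := b j) ht hj
    constructor
    · by_contra hne
      rw [mixedMonomialDeriv_zero (by have := ha (j + 1); omega), zero_mul, zero_add] at h2
      exact hH h2
    · intro hz
      rw [hz, mul_zero, zero_add] at h2
      exact hH h2
  have hall : ∀ i, w (k + i + i) ≠ 0 :=
    Fin.cyclic_induction (k := 0) (by simpa using hk) fun i hi => by
      rw [show k + (i + 1) + (i + 1) = k + i + i + 1 + 1 by abel]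
      exact (hstep _ hi).2
  have := hw.eq_one ha (fun i => (hstep _ (hall i)).1) k₂
  omega

end Transversality

theorem mainTheorem1 {n : ℕ} [NeZero n] (a b : Fin n → ℕ)
    (ha : ∀ j, 1 ≤ a j) (hb : ∃ j, 1 ≤ b j) (ha2 : ∃ k, 2 ≤ a k)
    (hw : HasPositiveWeights a)
    (r : ℝ) (hr : 0 < r) (t : ℝ) (ht : t ∈ Set.Icc (0 : ℝ) 1) :
    SphereTransversal a b t r := by
  rintro w ⟨hwr, hV⟩
  have hw0 : w ≠ 0 := by
    rintro rfl
    simp at hwr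
    exact hr.ne hwr
  obtain ⟨D, hD, -⟩ := exists_hasFDerivAt_fIIt a b t w
  refine .of_surjective hD.differentiableAt (hasStrictFDerivAt_norm_sq w).differentiableAt ?_
  set T := (fderiv ℝ (fIIt a b t) w).prod
    (fderiv ℝ (fun z : EuclideanSpace ℂ (Fin n) => ‖z‖ ^ 2) w) with hT
  refine (LinearMap.range_eq_top (f := T.toLinearMap)).1 ?_
  by_contra hne
  obtain ⟨φ, hφ, hle⟩ := Submodule.exists_le_ker_of_lt_top _ (lt_top_iff_ne_top.2 hne)
  obtain ⟨lam, μ, hlm⟩ := φ.exists_re_mul_add_mul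
  obtain ⟨rfl, rfl⟩ := covector_eq_zero ha ha2 hw ht hw0 hV (lam := lam) (μ := μ) fun v => by
    rw [← hlm]
    exact hle ⟨v, rfl⟩
  exact hφ (LinearMap.ext fun x => by rw [← Prod.mk.eta (p := x), hlm]; simp)
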